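/- Throughout, posets and graphs are finite. The height of a poset $P$ is the maximum size of a chain in $P$. The dimension of $P$ is the minimum number $d$ of linear orders $L_1,\dots,L_d$ on the ground set of $P$ such that, for all $x,y\in P$, $x\le_P y$ if and only if $x\le_{L_i}y$ for every $1\le i\le d$. The cover graph of $P$ is the graph on the elements of $P$ in which $x$ and $y$ are adjacent if and only if one of them covers the other, that is, $x<_Py$ with no $z$ such that $x<_Pz<_Py$, or vice versa. A tree decomposition of a graph $G$ is a tree $T$ with a set (bag) $B_t\subseteq V(G)$ for each node $t$ of $T$ such that both endpoints of every edge of $G$ lie in a common bag and, for every vertex $v$ of $G$, the set $\{t\in V(T): v\in B_t\}$ induces a non-empty subtree of $T$. The tree-width of $G$ is the minimum integer $k\ge 0$ such that $G$ has a tree decomposition with every bag of size at most $k+1$. Theorem (Joret et al.). There is a function $D\colon\mathbb{N}\times\mathbb{N}\to\mathbb{N}$ such that, for all $h,k\in\mathbb{N}$, every poset of height at most $h$ whose cover graph has tree-width at most $k$ has dimension at most $D(h,k)$. -/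

import Mathlib

/-- A tree decomposition of a graph `G`: a finite tree together with a bag of vertices of `G` for
each node, such that both endpoints of every edge lie in a common bag, and for every vertex `v`
the nodes whose bags contain `v` form a (nonempty, connected) subtree. -/
structure TreeDecomposition {V : Type*} (G : SimpleGraph V) where
  /-- The nodes of the tree. -/
  Node : Type
  finite_node : Finite Node
  /-- The tree. -/
  tree : SimpleGraph Node
  isTree : tree.IsTree
  /-- The bag of each node. -/
  bag : Node → Set V
  exists_bag_of_adj : ∀ ⦃u v : V⦄, G.Adj u v → ∃ t, u ∈ bag t ∧ v ∈ bag t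
  subtree : ∀ v : V, (tree.induce {t | v ∈ bag t}).Connected

/-- The tree-width of `G`: the least natural number `k` such that `G` has a tree decomposition
with every bag of size at most `k + 1` (and `⊤` if there is none, which never happens for a
finite graph). -/
noncomputable def treeWidth {V : Type*} (G : SimpleGraph V) : ℕ∞ :=
  sInf {w | ∃ k : ℕ, w = k ∧ ∃ T : TreeDecomposition G, ∀ t, (T.bag t).encard ≤ k + 1}

/-- The height of a poset: the maximum size of a chain. -/
noncomputable def posetHeight (P : Type*) [PartialOrder P] : ℕ∞ :=
  (Set.univ : Set P).chainHeight (· ≤ ·)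

/-- The linear orders `L i` form a realizer of the poset `P`: they are linear extensions of `P`
whose intersection is the order of `P`. -/
def IsRealizer {P : Type*} [PartialOrder P] {d : ℕ} (L : Fin d → LinearOrder P) : Prop :=
  ∀ x y : P, x ≤ y ↔ ∀ i, (L i).le x y

/-- The (Dushnik–Miller) dimension of a poset: the least number of linear orders that form a
realizer (and `⊤` if there is no finite realizer, which never happens for a finite poset). -/
noncomputable def posetDimension (P : Type*) [PartialOrder P] : ℕ∞ :=
  sInf {w | ∃ d : ℕ, w = d ∧ ∃ L : Fin d → LinearOrder P, IsRealizer L}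

/-! It suffices to partition the pairs with x ≰ y into boundedly many classes without alternating
cycles, since each class is reversed by one linear extension. Ranking vertices by depth in a tree
decomposition bounds the sets of weakly reachable vertices (`encard_weakReach_le`), so boundedly
many colours separate vertices weakly reachable within 3h steps. Classify pairs by three bits per
colour (`colorSignature`), hence 8 ^ N classes for N colours. Given an alternating cycle in one
class, let z have least rank among the elements between its comparabilities. Each pair of the cycle
then has a unique weakly reachable u above x and v below y of the colour of z. Across a
comparability, such u and v coincide once one of them has rank at most that of z. The shared bit f u
< f v then forces an endless descent of ranks around the cycle. -/

namespace SimpleGraph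

variable {V : Type*} {G : SimpleGraph V}

/-! ### Ranking vertices by depth in a tree decomposition -/

/-- `x` lies below `a` with respect to the root `r`: every walk from `r` to `x` visits `a`. -/
def IsBelow (G : SimpleGraph V) (r a x : V) : Prop :=
  ∀ w : G.Walk r x, a ∈ w.support

theorem isBelow_self (r a : V) : G.IsBelow r a a := fun w => w.end_mem_support

theorem IsBelow.of_adj {r a x y : V} (h : G.IsBelow r a x) (hxa : x ≠ a) (hxy : G.Adj x y) :
    G.IsBelow r a y := by
  intro w
  have := h (w.concat hxy.symm)
  rw [Walk.support_concat, List.mem_append, List.mem_singleton] at this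
  exact this.resolve_right hxa.symm

theorem IsBelow.dist_lt (hG : G.Connected) {r a x : V} (h : G.IsBelow r a x) (hxa : x ≠ a) :
    G.dist r a < G.dist r x := by
  classical
  obtain ⟨w, hw⟩ := hG.exists_walk_length_eq_dist r x
  rw [← hw]
  exact (dist_le _).trans_lt (w.length_takeUntil_lt_length (h w) hxa.symm)

/-- A path to `y` avoiding `a`, extended by the edge to `a`, is the unique path from `r` to `a`,
hence a geodesic; so `y` would be closer to `r`. -/
theorem IsTree.isBelow_of_adj (hG : G.IsTree) {r a y : V} (hay : G.Adj a y)
    (hd : G.dist r a ≤ G.dist r y) : G.IsBelow r a y := by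
  classical
  intro w
  by_contra hw
  have hp : a ∉ w.bypass.support := fun h => hw (w.support_bypass_subset_support h)
  obtain ⟨q, hq, hql⟩ := hG.connected.exists_path_of_dist r a
  have hpath : (w.bypass.concat hay.symm).IsPath := w.bypass_isPath.concat hp hay.symm
  have heq := congrArg Subtype.val
    ((hG.isAcyclic.subsingleton_path r a).elim ⟨_, hpath⟩ ⟨q, hq⟩)
  simp only at heq
  rw [← heq, Walk.length_concat] at hql
  have := dist_le w.bypass
  omega

theorem Preconnected.forall_of_forall_adj {s : Set V} (hs : (G.induce s).Preconnected)
    {p : V → Prop} (hp : ∀ x ∈ s, ∀ y ∈ s, p x → G.Adj x y → p y) {x y : V} (hx : x ∈ s)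
    (hy : y ∈ s) (hpx : p x) : p y := by
  obtain ⟨w⟩ := hs ⟨x, hx⟩ ⟨y, hy⟩
  have : ∀ (a b : s), (G.induce s).Walk a b → p a → p b := by
    intro a b w
    induction w with
    | nil => exact id
    | cons h _ ih => exact fun ha => ih (hp _ (Subtype.prop _) _ (Subtype.prop _) ha h)
  exact this _ _ w hpx

theorem IsTree.forall_isBelow (hG : G.IsTree) {r a s : V} {S : Set V}
    (hS : (G.induce S).Preconnected) (hd : ∀ x ∈ S, G.dist r a ≤ G.dist r x) (hs : s ∈ S)
    (hsa : G.IsBelow r a s) : ∀ x ∈ S, G.IsBelow r a x := by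
  intro x hx
  refine hS.forall_of_forall_adj (fun x _ y hy h hxy => ?_) hs hx hsa
  by_cases hxa : x = a
  · subst hxa
    exact hG.isBelow_of_adj hxy (hd y hy)
  · exact h.of_adj hxa hxy

/-- A connected set avoiding `a` cannot leave the part below `a`, where every vertex is strictly
deeper than `a`. -/
theorem IsBelow.mem_of_dist_le (hG : G.Connected) {r a s b : V} {S : Set V}
    (hS : (G.induce S).Preconnected) (hs : s ∈ S) (hsa : G.IsBelow r a s) (hb : b ∈ S)
    (hd : G.dist r b ≤ G.dist r a) : a ∈ S := by
  by_contra ha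
  have hne : ∀ x ∈ S, x ≠ a := fun x hx h => ha (h ▸ hx)
  have hba : G.IsBelow r a b :=
    hS.forall_of_forall_adj (fun x hx _ _ h hxy => h.of_adj (hne x hx) hxy) hs hb hsa
  exact absurd (hba.dist_lt hG (hne b hb)) (by omega)

/-- A finite graph with a tree decomposition has an injective vertex ranking such that the first
vertex of smaller rank met by a walk from `v` lies in a bag depending only on `v`. -/
theorem exists_ranking_of_treeDecomposition [Finite V] (T : TreeDecomposition G) :
    ∃ (f : V → ℕ ×ₗ ℕ) (t : V → T.Node), Function.Injective f ∧
      ∀ v x u (w : G.Walk v x), (∀ y ∈ w.support, f v ≤ f y) → G.Adj x u → f u < f v →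
        u ∈ T.bag (t v) := by
  obtain ⟨r⟩ := T.isTree.connected.nonempty
  obtain ⟨e, he⟩ := exists_injective_nat V
  have htop : ∀ v, ∃ t, v ∈ T.bag t ∧ ∀ s, v ∈ T.bag s → T.tree.dist r t ≤ T.tree.dist r s := by
    intro v
    obtain ⟨⟨t₀, ht₀⟩⟩ := (T.subtree v).nonempty
    have := T.finite_node
    obtain ⟨t, ht, hmin⟩ := Set.exists_min_image {t | v ∈ T.bag t} (fun t => T.tree.dist r t)
      (Set.toFinite _) ⟨t₀, ht₀⟩
    exact ⟨t, ht, hmin⟩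
  choose t ht hmin using htop
  have hfst : ∀ {a b : ℕ ×ₗ ℕ}, a ≤ b → (ofLex a).1 ≤ (ofLex b).1 := fun h =>
    Prod.Lex.monotone_fst_ofLex h
  -- Rank by the depth of the topmost bag containing `v`; the second coordinate only breaks ties.
  refine ⟨fun v => toLex (T.tree.dist r (t v), e v), t, fun a b hab => he ?_, ?_⟩
  · exact congrArg (fun p => (ofLex p).2) hab
  intro v x u w hw hxu hu
  have hbelow : ∀ x (w : G.Walk v x),
      (∀ y ∈ w.support, T.tree.dist r (t v) ≤ T.tree.dist r (t y)) →
      ∀ s, x ∈ T.bag s → T.tree.IsBelow r (t v) s := by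
    clear hu hxu hw w
    intro x w
    induction w using Walk.concatRec with
    | Hnil =>
      intro _ s hs
      exact T.isTree.forall_isBelow (T.subtree _).preconnected (hmin _) (ht _)
        (isBelow_self _ _) s hs
    | Hconcat w h ih =>
      intro hd s hs
      obtain ⟨s', hs₁, hs₂⟩ := T.exists_bag_of_adj h
      refine T.isTree.forall_isBelow (T.subtree _).preconnected
        (fun z hz => (hd _ (by simp)).trans (hmin _ z hz)) hs₂
        (ih (fun y hy => hd y (by simp [Walk.support_concat, hy])) s' hs₁) s hs
  obtain ⟨s, hs₁, hs₂⟩ := T.exists_bag_of_adj hxu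
  exact (hbelow x w (fun y hy => hfst (hw y hy)) s hs₁).mem_of_dist_le T.isTree.connected
    (T.subtree u).preconnected hs₂ (ht u) (hfst hu.le)

/-! ### Weak reachability and colouring -/

section WeakReach

variable {α : Type*} [LinearOrder α] {f : V → α}

/-- `u` is weakly `r`-reachable from `v` with respect to the ranking `f`: there is a walk of
length at most `r` from `v` to `u` on which `u` has minimum rank. -/
def WeakReach (G : SimpleGraph V) (f : V → α) (r : ℕ) (v u : V) : Prop :=
  ∃ w : G.Walk v u, w.length ≤ r ∧ ∀ y ∈ w.support, f u ≤ f y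

theorem WeakReach.le {r : ℕ} {v u : V} (h : G.WeakReach f r v u) : f u ≤ f v := by
  obtain ⟨w, _, hw⟩ := h
  exact hw _ w.start_mem_support

theorem weakReach_self (r : ℕ) (v : V) : G.WeakReach f r v v := ⟨Walk.nil, by simp, by simp⟩

/-- `p` is the first vertex of `w` of rank below `f v`; `w₀` accumulates the part already traversed.
-/
theorem exists_first_lt {B : V → Set V}
    (hB : ∀ v x u (w : G.Walk v x), (∀ y ∈ w.support, f v ≤ f y) → G.Adj x u → f u < f v → u ∈ B v)
    {v x u : V} (w : G.Walk x u) (w₀ : G.Walk v x) (hw₀ : ∀ y ∈ w₀.support, f v ≤ f y)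
    (hu : f u < f v) :
    ∃ p ∈ B v, ∃ w' : G.Walk p u, w'.length < w.length ∧ w'.support ⊆ w.support := by
  induction w with
  | nil => exact absurd (hw₀ _ w₀.end_mem_support) hu.not_ge
  | @cons x y u h w ih =>
    rcases lt_or_ge (f y) (f v) with hy | hy
    · exact ⟨y, hB _ _ _ w₀ hw₀ h hy, w, by simp, by simp⟩
    · obtain ⟨p, hp, w', hl, hs⟩ := ih (w₀.concat h) (by
        intro z hz
        rw [Walk.support_concat, List.mem_append, List.mem_singleton] at hz
        rcases hz with hz | rfl
        exacts [hw₀ z hz, hy]) hu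
      exact ⟨p, hp, w', by simp; omega, fun z hz => by simp [hs hz]⟩

/-- Either `u = v`, or `u` is weakly reachable in fewer steps from one of at most k + 1 vertices of
`B v`; and 1 + (k + 1)(k + 2) ^ r ≤ (k + 2) ^ (r + 1). -/
theorem encard_weakReach_le (hf : Function.Injective f) {B : V → Set V} {k : ℕ}
    (hk : ∀ v, (B v).encard ≤ k + 1)
    (hB : ∀ v x u (w : G.Walk v x), (∀ y ∈ w.support, f v ≤ f y) → G.Adj x u → f u < f v → u ∈ B v)
    (r : ℕ) (v : V) : {u | G.WeakReach f r v u}.encard ≤ ((k + 2) ^ r : ℕ) := by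
  induction r generalizing v with
  | zero =>
    have : {u | G.WeakReach f 0 v u} ⊆ {v} := by
      rintro u ⟨w, hw, _⟩
      exact (Walk.eq_of_length_eq_zero (Nat.le_zero.1 hw)).symm
    simpa using Set.encard_le_encard this
  | succ r ih =>
    have hfin : (B v).Finite := Set.finite_of_encard_le_coe (k := k + 1) (by exact_mod_cast hk v)
    have hsub : {u | G.WeakReach f (r + 1) v u} ⊆
        insert v (⋃ b ∈ hfin.toFinset, {u | G.WeakReach f r b u}) := by
      rintro u ⟨w, hw, hmin⟩
      by_cases huv : u = v
      · exact Or.inl huv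
      have hlt : f u < f v := (hmin _ w.start_mem_support).lt_of_ne (hf.ne huv)
      obtain ⟨p, hp, w', hl, hs⟩ := exists_first_lt hB w Walk.nil (by simp) hlt
      refine Or.inr (Set.mem_biUnion (by simpa using hp)
        (⟨w', by omega, fun y hy => hmin y (hs hy)⟩ : G.WeakReach f r p u))
    have hcard : hfin.toFinset.card ≤ k + 1 := by
      have := hk v
      rw [hfin.encard_eq_coe_toFinset_card] at this
      exact_mod_cast this
    have hun : ∀ s : Finset V, (⋃ b ∈ s, {u | G.WeakReach f r b u}).encard ≤
        (s.card * (k + 2) ^ r : ℕ) := by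
      classical
      intro s
      induction s using Finset.induction_on with
      | empty => simp
      | insert a s ha ihs =>
        rw [Finset.set_biUnion_insert, Finset.card_insert_of_notMem ha]
        refine (Set.encard_union_le _ _).trans ((add_le_add (ih a) ihs).trans ?_)
        rw [← Nat.cast_add]
        exact_mod_cast (by ring_nf; exact le_rfl)
    calc _ ≤ _ := Set.encard_le_encard hsub
      _ ≤ _ := Set.encard_insert_le _ _
      _ ≤ ((hfin.toFinset.card * (k + 2) ^ r : ℕ) : ℕ∞) + 1 := by gcongr; exact hun _
      _ ≤ ((k + 2) ^ (r + 1) : ℕ) := by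
        have h1 : 1 ≤ (k + 2) ^ r := Nat.one_le_pow _ _ (by omega)
        have h2 := Nat.mul_le_mul_right ((k + 2) ^ r) hcard
        have h3 : hfin.toFinset.card * (k + 2) ^ r + 1 ≤ (k + 2) ^ (r + 1) := by
          rw [pow_succ]; nlinarith
        exact_mod_cast h3

/-- Greedy colouring by increasing rank: at most N colours are forbidden at each new vertex. -/
theorem exists_coloring_weakReach [Finite V] (hf : Function.Injective f) {r N : ℕ}
    (hN : ∀ v, {u | G.WeakReach f r v u}.encard ≤ N) :
    ∃ φ : V → Fin (N + 1), ∀ u v, G.WeakReach f r v u → φ u = φ v → u = v := by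
  classical
  have := Fintype.ofFinite V
  have key : ∀ s : Finset V, ∃ φ : V → Fin (N + 1),
      ∀ u ∈ s, ∀ v ∈ s, G.WeakReach f r v u → φ u = φ v → u = v := by
    intro s
    induction s using Finset.induction_on_max_value f with
    | empty => exact ⟨fun _ => 0, by simp⟩
    | insert a s ha hmax ih =>
      obtain ⟨φ, hφ⟩ := ih
      obtain ⟨c, hc⟩ : ∃ c, c ∉ φ '' {u | G.WeakReach f r a u} := by
        by_contra! h
        have h1 : (φ '' {u | G.WeakReach f r a u}) = Set.univ := Set.eq_univ_of_forall h
        have h2 := (Set.encard_image_le φ {u | G.WeakReach f r a u}).trans (hN a)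
        rw [h1, Set.encard_univ, ENat.card_eq_coe_fintype_card, Fintype.card_fin] at h2
        have : N + 1 ≤ N := by exact_mod_cast h2
        omega
      refine ⟨Function.update φ a c, fun u hu v hv h huv => ?_⟩
      by_contra hne
      rcases Finset.mem_insert.1 hv with rfl | hv
      · rw [Function.update_self, Function.update_of_ne hne] at huv
        exact hc ⟨u, h, huv⟩
      · rcases Finset.mem_insert.1 hu with rfl | hu
        · exact hne (hf (h.le.antisymm (hmax v ‹v ∈ s›)))
        · have hua : u ≠ a := fun h => ha (h ▸ hu)
          have hva : v ≠ a := fun h => ha (h ▸ hv)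
          rw [Function.update_of_ne hua, Function.update_of_ne hva] at huv
          exact hne (hφ u hu v hv h huv)
  obtain ⟨φ, hφ⟩ := key Finset.univ
  exact ⟨φ, fun u v => hφ u (Finset.mem_univ _) v (Finset.mem_univ _)⟩

end WeakReach

end SimpleGraph

/-! ### Dimension via alternating cycles -/

section Poset

variable {P : Type*} [PartialOrder P]

/-- A set of pairs without alternating cycles is reversed by a linear extension. -/
theorem exists_linearExtension_reversing {S : Set (P × P)}
    (hS : ∀ p, ¬ Relation.TransGen (fun p q : P × P => p ∈ S ∧ q ∈ S ∧ p.1 ≤ q.2) p p) :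
    ∃ s : P → P → Prop, IsLinearOrder P s ∧ (∀ x y, x ≤ y → s x y) ∧ ∀ p ∈ S, ¬ s p.1 p.2 := by
  set E : P × P → P × P → Prop := fun p q => p ∈ S ∧ q ∈ S ∧ p.1 ≤ q.2
  -- Transitive closure of the order with `p.2` put below `p.1` for each `p ∈ S`; a failure of
  -- antisymmetry would be an alternating cycle.
  let R : P → P → Prop := fun x y =>
    x ≤ y ∨ ∃ p ∈ S, ∃ q ∈ S, x ≤ p.2 ∧ Relation.ReflTransGen E p q ∧ q.1 ≤ y
  have hR : IsPartialOrder P R :=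
    { refl := fun x => Or.inl le_rfl
      trans := by
        rintro x y z (hxy | ⟨p, hp, q, hq, h₁, h₂, h₃⟩) (hyz | ⟨p', hp', q', hq', h₁', h₂', h₃'⟩)
        · exact Or.inl (hxy.trans hyz)
        · exact Or.inr ⟨p', hp', q', hq', hxy.trans h₁', h₂', h₃'⟩
        · exact Or.inr ⟨p, hp, q, hq, h₁, h₂, h₃.trans hyz⟩
        · exact Or.inr ⟨p, hp, q', hq', h₁,
            h₂.trans (Relation.ReflTransGen.head ⟨hq, hp', h₃.trans h₁'⟩ h₂'), h₃'⟩
      antisymm := by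
        rintro x y (hxy | ⟨p, hp, q, hq, h₁, h₂, h₃⟩) (hyx | ⟨p', hp', q', hq', h₁', h₂', h₃'⟩)
        · exact le_antisymm hxy hyx
        · exact (hS p' (Relation.TransGen.tail' h₂'
            ⟨hq', hp', h₃'.trans (hxy.trans h₁')⟩)).elim
        · exact (hS p (Relation.TransGen.tail' h₂ ⟨hq, hp, h₃.trans (hyx.trans h₁)⟩)).elim
        · exact (hS p (Relation.TransGen.tail'
            (h₂.trans (Relation.ReflTransGen.head ⟨hq, hp', h₃.trans h₁'⟩ h₂'))
            ⟨hq', hp, h₃'.trans h₁⟩)).elim }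
  obtain ⟨s, hs, hRs⟩ := extend_partialOrder R
  refine ⟨s, hs, fun x y hxy => hRs _ _ (Or.inl hxy), fun p hp hle => ?_⟩
  have h1 : s p.2 p.1 := hRs _ _ (Or.inr ⟨p, hp, p, hp, le_rfl, .refl, le_rfl⟩)
  have h2 : p.1 = p.2 := hs.antisymm _ _ hle h1
  exact hS p (.single ⟨hp, hp, h2.le⟩)

theorem posetDimension_le_of_cover {ι : Type*} [Fintype ι] (S : ι → Set (P × P))
    (hcover : ∀ x y : P, ¬ x ≤ y → ∃ i, (x, y) ∈ S i)
    (hS : ∀ i p, ¬ Relation.TransGen (fun p q : P × P => p ∈ S i ∧ q ∈ S i ∧ p.1 ≤ q.2) p p) :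
    posetDimension P ≤ Fintype.card ι := by
  choose s hs hle hrev using fun i => exists_linearExtension_reversing (hS i)
  let L : ι → LinearOrder P := fun i =>
    { le := s i
      lt := fun a b => s i a b ∧ ¬ s i b a
      le_refl := (hs i).refl
      le_trans := (hs i).trans
      lt_iff_le_not_ge := fun _ _ => Iff.rfl
      le_antisymm := (hs i).antisymm
      le_total := (hs i).total
      toDecidableLE := Classical.decRel _ }
  refine sInf_le ⟨Fintype.card ι, rfl, fun i => L ((Fintype.equivFin ι).symm i), fun x y =>
    ⟨fun h i => hle _ x y h, fun h => ?_⟩⟩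
  by_contra hxy
  obtain ⟨i, hi⟩ := hcover x y hxy
  have hle' : s ((Fintype.equivFin ι).symm (Fintype.equivFin ι i)) x y := h _
  rw [Equiv.symm_apply_apply] at hle'
  exact hrev i _ hi hle'

/-- Comparable elements are joined by a walk in the cover graph that stays between them and
whose length is at most the height. -/
theorem exists_hasse_walk [Finite P] {h : ℕ} (hP : posetHeight P ≤ h) {x y : P} (hxy : x ≤ y) :
    ∃ w : (SimpleGraph.hasse P).Walk x y, w.length ≤ h ∧ ∀ z ∈ w.support, x ≤ z ∧ z ≤ y := by
  classical
  have := Fintype.ofFinite P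
  let _ : LocallyFiniteOrder P := Fintype.toLocallyFiniteOrder
  obtain ⟨w, hw, hwxy⟩ : ∃ w : (SimpleGraph.hasse P).Walk x y,
      w.support.Pairwise (· < ·) ∧ ∀ z ∈ w.support, x ≤ z ∧ z ≤ y := by
    have hc := le_iff_reflTransGen_covBy.1 hxy
    clear hxy
    induction hc using Relation.ReflTransGen.head_induction_on with
    | refl => exact ⟨.nil, by simp, by simp⟩
    | @head a b hab _ ih =>
      obtain ⟨w, hw, hwy⟩ := ih
      have hadj : (SimpleGraph.hasse P).Adj a b := Or.inl hab
      refine ⟨.cons hadj w, ?_, ?_⟩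
      · rw [SimpleGraph.Walk.support_cons, List.pairwise_cons]
        exact ⟨fun z hz => hab.lt.trans_le (hwy z hz).1, hw⟩
      · intro z hz
        rw [SimpleGraph.Walk.support_cons, List.mem_cons] at hz
        rcases hz with rfl | hz
        · exact ⟨le_rfl, hab.le.trans ((hwy b w.start_mem_support).2)⟩
        · exact ⟨hab.le.trans (hwy z hz).1, (hwy z hz).2⟩
  refine ⟨w, ?_, hwxy⟩
  have hchain : IsChain (· ≤ ·) (w.support.toFinset : Set P) := by
    intro a ha b hb hab
    simp only [List.coe_toFinset, Set.mem_ofPred_eq] at ha hb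
    have : Std.Symm fun a b : P => a ≤ b ∨ b ≤ a := ⟨fun _ _ => Or.symm⟩
    exact (hw.imp (S := fun a b => a ≤ b ∨ b ≤ a) (fun h => Or.inl h.le)).forall ha hb hab
  have hle := (Set.encard_le_chainHeight_of_isChain _ _ (Set.subset_univ _) hchain).trans hP
  rw [Set.encard_coe_eq_coe_finsetCard,
    List.toFinset_card_of_nodup (hw.imp fun h => h.ne), SimpleGraph.Walk.length_support] at hle
  have : w.length + 1 ≤ h := by exact_mod_cast hle
  omega

/-! ### Signature classes contain no alternating cycle -/

section Signature

open SimpleGraph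

variable {α : Type*} [LinearOrder α] {f : P → α} {N h : ℕ} {φ : P → Fin N}

/-- The colour-`c` information recorded for a pair `(x, y)`. -/
def colorSignature (f : P → α) (h : ℕ) (φ : P → Fin N) (p : P × P) (c : Fin N) :
    Prop × Prop × Prop :=
  (∃ u, p.1 ≤ u ∧ (hasse P).WeakReach f h p.1 u ∧ φ u = c,
   ∃ v, v ≤ p.2 ∧ (hasse P).WeakReach f h p.2 v ∧ φ v = c,
   ∃ u v, (p.1 ≤ u ∧ (hasse P).WeakReach f h p.1 u ∧ φ u = c) ∧
     (v ≤ p.2 ∧ (hasse P).WeakReach f h p.2 v ∧ φ v = c) ∧ f u < f v)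

/-- Vertices of one colour weakly reachable from the two ends of a walk coincide if no vertex of
the walk has smaller rank than both. -/
theorem eq_of_weakReach_of_walk
    (hφ : ∀ u v, (hasse P).WeakReach f (3 * h) v u → φ u = φ v → u = v)
    {a b u v : P} (hu : (hasse P).WeakReach f h a u) (hv : (hasse P).WeakReach f h b v)
    (w : (hasse P).Walk a b) (hw : w.length ≤ h)
    (hmin : ∀ y ∈ w.support, f u ≤ f y ∨ f v ≤ f y) (huv : φ u = φ v) : u = v := by
  obtain ⟨wu, hlu, hu⟩ := hu
  obtain ⟨wv, hlv, hv⟩ := hv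
  have hW : ∀ y ∈ ((wu.reverse.append w).append wv).support, f u ≤ f y ∨ f v ≤ f y := by
    intro y hy
    rw [Walk.mem_support_append_iff, Walk.mem_support_append_iff, Walk.support_reverse,
      List.mem_reverse] at hy
    rcases hy with (hy | hy) | hy
    exacts [Or.inl (hu y hy), hmin y hy, Or.inr (hv y hy)]
  -- Three pieces of length at most `h`: hence the radius 3h of the colouring.
  have hlen : ((wu.reverse.append w).append wv).length ≤ 3 * h := by
    simp only [Walk.length_append, Walk.length_reverse]
    omega
  rcases le_total (f u) (f v) with huv' | huv'
  · refine hφ u v ⟨((wu.reverse.append w).append wv).reverse, by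
      rwa [Walk.length_reverse], fun y hy => ?_⟩
      huv
    exact (hW y (by simpa [or_assoc, or_comm, or_left_comm] using hy)).elim id huv'.trans
  · exact (hφ v u ⟨(wu.reverse.append w).append wv, hlen, fun y hy =>
      (hW y hy).elim huv'.trans id⟩ huv.symm).symm

theorem not_transGen_of_colorSignature_eq [Finite P] (hf : Function.Injective f)
    (hP : posetHeight P ≤ h)
    (hφ : ∀ u v, (hasse P).WeakReach f (3 * h) v u → φ u = φ v → u = v)
    (σ : Fin N → Prop × Prop × Prop) {S : Set (P × P)}
    (hS : ∀ p ∈ S, ¬ p.1 ≤ p.2 ∧ colorSignature f h φ p = σ) (p : P × P) :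
    ¬ Relation.TransGen (fun p q : P × P => p ∈ S ∧ q ∈ S ∧ p.1 ≤ q.2) p p := by
  intro hp
  set E : P × P → P × P → Prop := fun p q => p ∈ S ∧ q ∈ S ∧ p.1 ≤ q.2
  -- The strong component of `p` replaces an indexed cycle: each member has a successor and a
  -- predecessor inside it.
  let C : Set (P × P) := {q | Relation.ReflTransGen E p q ∧ Relation.ReflTransGen E q p}
  have hpC : p ∈ C := ⟨.refl, .refl⟩
  have hcyc : ∀ q ∈ C, Relation.TransGen E q q := fun q hq =>
    Relation.TransGen.trans_right hq.2 (hp.trans_left hq.1)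
  have hsucc : ∀ q ∈ C, ∃ q' ∈ C, E q q' := by
    intro q hq
    obtain ⟨q', h1, h2⟩ := Relation.TransGen.head'_iff.1 (hcyc q hq)
    exact ⟨q', ⟨hq.1.tail h1, h2.trans hq.2⟩, h1⟩
  have hpred : ∀ q ∈ C, ∃ q' ∈ C, E q' q := by
    intro q hq
    obtain ⟨q', h1, h2⟩ := Relation.TransGen.tail'_iff.1 (hcyc q hq)
    exact ⟨q', ⟨hq.1.trans h1, .head h2 hq.2⟩, h2⟩
  have hCS : ∀ q ∈ C, q ∈ S := fun q hq => (hsucc q hq).choose_spec.2.1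
  -- the vertex of minimum rank lying between the elements of the cycle
  obtain ⟨p₁, hp₁, hpp₁⟩ := hsucc p hpC
  obtain ⟨z, ⟨a, ha, b, hb, haz, hzb⟩, hz⟩ :=
    Set.exists_min_image {z | ∃ a ∈ C, ∃ b ∈ C, a.1 ≤ z ∧ z ≤ b.2} f (Set.toFinite _)
      ⟨p.1, p, hpC, p₁, hp₁, le_rfl, hpp₁.2.2⟩
  have hza : (hasse P).WeakReach f h a.1 z := by
    obtain ⟨w, hw, hwz⟩ := exists_hasse_walk hP haz
    exact ⟨w, hw, fun y hy => hz y ⟨a, ha, b, hb, (hwz y hy).1, (hwz y hy).2.trans hzb⟩⟩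
  have hzb' : (hasse P).WeakReach f h b.2 z := by
    obtain ⟨w, hw, hwz⟩ := exists_hasse_walk hP hzb
    refine ⟨w.reverse, by simpa using hw, fun y hy => hz y ?_⟩
    rw [Walk.support_reverse, List.mem_reverse] at hy
    exact ⟨a, ha, b, hb, haz.trans (hwz y hy).1, (hwz y hy).2⟩
  have hwalk : ∀ q ∈ C, ∀ q' ∈ C, q.1 ≤ q'.2 → ∃ w : (hasse P).Walk q.1 q'.2,
      w.length ≤ h ∧ ∀ y ∈ w.support, f z ≤ f y := by
    intro q hq q' hq' hle
    obtain ⟨w, hw, hwz⟩ := exists_hasse_walk hP hle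
    exact ⟨w, hw, fun y hy => hz y ⟨q, hq, q', hq', hwz y hy⟩⟩
  let U : P × P → P → Prop := fun q u => q.1 ≤ u ∧ (hasse P).WeakReach f h q.1 u ∧ φ u = φ z
  let D : P × P → P → Prop := fun q v => v ≤ q.2 ∧ (hasse P).WeakReach f h q.2 v ∧ φ v = φ z
  have hsig : ∀ q ∈ C, ∀ q' ∈ C, ((∃ u, U q u) = ∃ u, U q' u) ∧ ((∃ v, D q v) = ∃ v, D q' v) ∧
      ((∃ u v, U q u ∧ D q v ∧ f u < f v) = ∃ u v, U q' u ∧ D q' v ∧ f u < f v) := by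
    intro q hq q' hq'
    have := congrFun ((hS q (hCS q hq)).2.trans (hS q' (hCS q' hq')).2.symm) (φ z)
    simpa only [colorSignature, Prod.mk.injEq] using this
  have hUex : ∀ q ∈ C, ∃ u, U q u := fun q hq =>
    (hsig a ha q hq).1.mp ⟨z, haz, hza, rfl⟩
  have hDex : ∀ q ∈ C, ∃ v, D q v := fun q hq =>
    (hsig b hb q hq).2.1.mp ⟨z, hzb, hzb', rfl⟩
  have hUU : ∀ q u u', U q u → U q u' → u = u' := fun q u u' hu hu' =>
    eq_of_weakReach_of_walk hφ hu.2.1 hu'.2.1 .nil (by simp)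
      (by simpa using Or.inl hu.2.1.le) (hu.2.2.trans hu'.2.2.symm)
  have hDD : ∀ q u u', D q u → D q u' → u = u' := fun q u u' hu hu' =>
    eq_of_weakReach_of_walk hφ hu.2.1 hu'.2.1 .nil (by simp)
      (by simpa using Or.inl hu.2.1.le) (hu.2.2.trans hu'.2.2.symm)
  -- The answer is the same for all of `C`. If yes, the `u` of a pair is the `v` of its successor,
  -- so ranks descend forwards; if no, they descend backwards.
  by_cases hlt : ∃ u v, U a u ∧ D a v ∧ f u < f v
  · obtain ⟨v, ⟨q, hq, hv, hvz⟩, hmin⟩ :=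
      Set.exists_min_image {v | ∃ q ∈ C, D q v ∧ f v ≤ f z} f (Set.toFinite _)
        ⟨z, b, hb, ⟨hzb, hzb', rfl⟩, le_rfl⟩
    obtain ⟨u, v', hu, hv', huv⟩ := (hsig a ha q hq).2.2.mp hlt
    obtain rfl := hDD q v v' hv hv'
    obtain ⟨q', hq', hqq'⟩ := hsucc q hq
    obtain ⟨v', hv'⟩ := hDex q' hq'
    obtain ⟨w, hw, hwz⟩ := hwalk q hq q' hq' hqq'.2.2
    obtain rfl := eq_of_weakReach_of_walk hφ hu.2.1 hv'.2.1 w hw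
      (fun y hy => Or.inl ((huv.le.trans hvz).trans (hwz y hy))) (hu.2.2.trans hv'.2.2.symm)
    exact (hmin u ⟨q', hq', hv', huv.le.trans hvz⟩).not_gt huv
  · obtain ⟨u, ⟨q, hq, hu, huz⟩, hmin⟩ :=
      Set.exists_min_image {u | ∃ q ∈ C, U q u ∧ f u ≤ f z} f (Set.toFinite _)
        ⟨z, a, ha, ⟨haz, hza, rfl⟩, le_rfl⟩
    obtain ⟨v, hv⟩ := hDex q hq
    have huv : f v < f u := by
      refine lt_of_le_of_ne (not_lt.1 fun hlt' => hlt ?_) fun h => ?_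
      · exact (hsig a ha q hq).2.2.mpr ⟨u, v, hu, hv, hlt'⟩
      -- Equal ranks would give `q.1 ≤ u = v ≤ q.2`.
      · obtain rfl := hf h
        exact (hS q (hCS q hq)).1 (hu.1.trans hv.1)
    obtain ⟨q', hq', hqq'⟩ := hpred q hq
    obtain ⟨u', hu'⟩ := hUex q' hq'
    obtain ⟨w, hw, hwz⟩ := hwalk q' hq' q hq hqq'.2.2
    obtain rfl := eq_of_weakReach_of_walk hφ hu'.2.1 hv.2.1 w hw
      (fun y hy => Or.inr ((huv.le.trans huz).trans (hwz y hy))) (hu'.2.2.trans hv.2.2.symm)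
    exact (hmin u' ⟨q', hq', hu', huv.le.trans huz⟩).not_gt huv

theorem posetDimension_le_of_coloring [Finite P] (hf : Function.Injective f)
    (hP : posetHeight P ≤ h)
    (hφ : ∀ u v, (hasse P).WeakReach f (3 * h) v u → φ u = φ v → u = v) :
    posetDimension P ≤ (8 ^ N : ℕ) := by
  classical
  have := posetDimension_le_of_cover
    (fun σ : Fin N → Prop × Prop × Prop => {p : P × P | ¬ p.1 ≤ p.2 ∧ colorSignature f h φ p = σ})
    (fun x y hxy => ⟨_, hxy, rfl⟩)
    (fun σ p => not_transGen_of_colorSignature_eq hf hP hφ σ (fun _ hp => hp) p)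
  simpa using this

end Signature

end Poset

theorem exists_treeDecomposition_of_treeWidth_le {V : Type*} {G : SimpleGraph V} {k : ℕ}
    (h : treeWidth G ≤ k) : ∃ T : TreeDecomposition G, ∀ t, (T.bag t).encard ≤ k + 1 := by
  have hlt : treeWidth G < ((k + 1 : ℕ) : ℕ∞) := h.trans_lt (by exact_mod_cast k.lt_succ_self)
  obtain ⟨_, ⟨j, rfl, T, hT⟩, hj⟩ := sInf_lt_iff.1 hlt
  have hjk : j ≤ k := Nat.lt_succ_iff.1 (by exact_mod_cast hj)
  exact ⟨T, fun t => (hT t).trans (by gcongr)⟩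

theorem mainTheorem4 :
    ∃ D : ℕ → ℕ → ℕ, ∀ (h k : ℕ) (P : Type*) [PartialOrder P] [Finite P],
      posetHeight P ≤ h → treeWidth (SimpleGraph.hasse P) ≤ k → posetDimension P ≤ D h k := by
  -- Greedy colouring needs one colour more than the bound on weakly reachable sets.
  refine ⟨fun h k => 8 ^ ((k + 2) ^ (3 * h) + 1), fun h k P _ _ hP hk => ?_⟩
  obtain ⟨T, hT⟩ := exists_treeDecomposition_of_treeWidth_le hk
  obtain ⟨f, t, hf, hB⟩ := SimpleGraph.exists_ranking_of_treeDecomposition T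
  obtain ⟨φ, hφ⟩ := SimpleGraph.exists_coloring_weakReach hf
    (SimpleGraph.encard_weakReach_le hf (fun v => hT (t v)) hB (3 * h))
  exact posetDimension_le_of_coloring hf hP hφ
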